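/- Let $G$ be a finite simple graph. A leaf of $G$ is a vertex of degree one, and a support vertex of $G$ is a vertex adjacent to a leaf. A total Roman $\{2\}$-dominating function on $G$ is a function $f:V(G)\to\{0,1,2\}$ such that every vertex $v$ with $f(v)=0$ has a neighbor $u$ with $f(u)=2$ or two distinct neighbors $x,y$ with $f(x)=f(y)=1$, and such that the subgraph of $G$ induced by $\{v : f(v)>0\}$ has no isolated vertices. For $G$ without isolated vertices, $\gamma_{tR2}(G)$ denotes the minimum of the weight $\sum_{v\in V(G)}f(v)$ over all such functions $f$. The corona of a graph $H$ is the graph obtained from $H$ by attaching to each vertex of $H$ one new vertex of degree $1$. Theorem. For every finite tree $T$ of order $n(T)\ge 4$ with $s(T)$ support vertices, $$\gamma_{tR2}(T)\le\frac{3n(T)+2s(T)}{4},$$ with equality if and only if $T$ is (isomorphic to) the corona of a tree. -/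

import Mathlib

universe u

namespace TotalRoman

section Defs

variable {V : Type u}

/-- A leaf of `G` is a vertex of degree one. -/
def IsLeaf (G : SimpleGraph V) (v : V) : Prop :=
  (G.neighborSet v).ncard = 1

/-- A support vertex of `G` is a vertex adjacent to a leaf. -/
def IsSupportVertex (G : SimpleGraph V) (v : V) : Prop :=
  ∃ w, G.Adj v w ∧ IsLeaf G w

/-- The number of support vertices of `G`. -/
noncomputable def supportCount (G : SimpleGraph V) : ℕ :=
  {v | IsSupportVertex G v}.ncard

/-- A total Roman `{2}`-dominating function: a function `V → {0, 1, 2}` such that every vertex of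
value `0` has a neighbour of value `2` or two distinct neighbours of value `1`, and such that the
subgraph induced by the vertices of positive value has no isolated vertices. -/
structure IsTR2DF (G : SimpleGraph V) (f : V → ℕ) : Prop where
  le_two : ∀ v, f v ≤ 2
  dominates : ∀ v, f v = 0 →
    (∃ u, G.Adj v u ∧ f u = 2) ∨
      (∃ x y, x ≠ y ∧ G.Adj v x ∧ G.Adj v y ∧ f x = 1 ∧ f y = 1)
  total : ∀ v, 0 < f v → ∃ u, G.Adj v u ∧ 0 < f u

/-- The total Roman `{2}`-domination number of a finite graph: the minimum weight `∑ v, f v` of a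
total Roman `{2}`-dominating function. -/
noncomputable def gammaTR2 [Fintype V] (G : SimpleGraph V) : ℕ :=
  sInf {w | ∃ f : V → ℕ, IsTR2DF G f ∧ ∑ v, f v = w}

/-- If `G` has no isolated vertices, then the constant function `1` is a total Roman
`{2}`-dominating function, so the minimum in `gammaTR2` is over a nonempty set. -/
theorem isTR2DF_one {G : SimpleGraph V} (h : ∀ v, ∃ u, G.Adj v u) :
    IsTR2DF G (fun _ => 1) where
  le_two _ := by norm_num
  dominates _ h0 := absurd h0 one_ne_zero
  total v _ := (h v).imp fun _ hu => ⟨hu, one_pos⟩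

/-- The corona of `H`: one new vertex `inr a` of degree one is attached to each vertex `inl a`
of `H`. -/
def corona (H : SimpleGraph V) : SimpleGraph (V ⊕ V) where
  Adj x y :=
    match x, y with
    | Sum.inl a, Sum.inl b => H.Adj a b
    | Sum.inl a, Sum.inr b => a = b
    | Sum.inr a, Sum.inl b => a = b
    | Sum.inr _, Sum.inr _ => False
  symm := ⟨by
    rintro (a | a) (b | b) h
    · exact SimpleGraph.Adj.symm h
    · exact Eq.symm h
    · exact Eq.symm h
    · exact h⟩
  loopless := ⟨by
    rintro (a | a) h
    · exact H.loopless.irrefl a h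
    · exact h⟩

/-- `G` is (isomorphic to) the corona of a tree. -/
def IsCoronaOfTree (G : SimpleGraph V) : Prop :=
  ∃ (W : Type u) (H : SimpleGraph W), H.IsTree ∧ Nonempty (G ≃g corona H)

end Defs

end TotalRoman

/-! Every finite tree arises from single vertices by repeatedly making the root of one rooted tree a
child of the root of another. Phrased through neighbour sums (`need`, `nbrSum`), domination is
additive under such a join: only the two roots gain a neighbour. So a rooted tree matters only
through its available triples (x, p, b): value x at the root, neighbour sum at least p there, and
excess 4·weight − 3n − 2s at most b. Nine lists of triples, the `Profile`s, suffice, because the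
join of any two realises the list of a third; this is a finite check, `exists_bounds_of_mem_join`.
Support vertices are counted only through leaves other than the root, since the root may still gain
neighbours. When the tree is rooted at a vertex with two neighbours and n ≥ 4, the last join has
excess at most 0, and negative excess unless its profile is `corona` (`exists_bounds_lt`). The shape
carried along with the profile then exhibits the tree as a corona. Conversely, in a corona each
vertex together with its leaf has weight at least 2, so the weight is at least n, while s ≤ n/2. -/

namespace TotalRoman

/-! ### Domination in terms of neighbour sums -/

open Classical in
/-- The sum of `f` over the neighbours of `v`. -/
noncomputable def nbrSum {V : Type*} [Fintype V] (G : SimpleGraph V) (f : V → ℕ) (v : V) : ℕ :=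
  ∑ w, if G.Adj v w then f w else 0

/-- The neighbour sum that a vertex of value `x` requires in a total Roman `{2}`-dominating
function. -/
def need (x : ℕ) : ℕ := if x = 0 then 2 else 1

section Basic

variable {V : Type u} [Fintype V] {G : SimpleGraph V} {f : V → ℕ}

theorem exists_adj_pos_of_nbrSum_pos {v : V} (h : 0 < nbrSum G f v) :
    ∃ u, G.Adj v u ∧ 0 < f u := by
  by_contra! hc
  refine h.ne' (Finset.sum_eq_zero fun w _ => ?_)
  split_ifs with hw
  · exact Nat.le_zero.mp (hc w hw)
  · rfl

/-- A function into `{0, 1, 2}` with sufficiently large neighbour sums is total Roman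
`{2}`-dominating. -/
theorem isTR2DF_of_need_le (h2 : ∀ v, f v ≤ 2) (hs : ∀ v, need (f v) ≤ nbrSum G f v) :
    IsTR2DF G f where
  le_two := h2
  dominates v hv := by
    classical
    have h := hs v
    rw [hv] at h
    by_contra! hc
    obtain ⟨hc2, hc1⟩ := hc
    have hle : ∀ w, G.Adj v w → f w ≤ 1 := fun w hw => by
      have := hc2 w hw
      have := h2 w
      omega
    obtain ⟨x, hx, hx0⟩ := exists_adj_pos_of_nbrSum_pos (lt_of_lt_of_le (by decide) h)
    have hx1 : f x = 1 := le_antisymm (hle x hx) hx0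
    -- A second positive neighbour would also have value 1, giving the excluded pair.
    have : nbrSum G f v = 1 := by
      unfold nbrSum
      rw [Finset.sum_eq_single x]
      · simp [hx, hx1]
      · intro y _ hyx
        split_ifs with hy
        · have := hc1 x y hyx.symm hx hy hx1
          have := hle y hy
          omega
        · rfl
      · simp
    rw [this] at h
    exact absurd h (by decide)
  total v hv := by
    have h := hs v
    rw [need, if_neg hv.ne'] at h
    exact exists_adj_pos_of_nbrSum_pos h

theorem gammaTR2_le (hf : IsTR2DF G f) : gammaTR2 G ≤ ∑ v, f v :=
  Nat.sInf_le ⟨f, hf, rfl⟩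

theorem exists_isTR2DF_sum_eq_gammaTR2 (hf : IsTR2DF G f) :
    ∃ g : V → ℕ, IsTR2DF G g ∧ ∑ v, g v = gammaTR2 G :=
  Nat.sInf_mem (s := {w | ∃ f : V → ℕ, IsTR2DF G f ∧ ∑ v, f v = w}) ⟨_, f, hf, rfl⟩

end Basic

/-! ### Joining two rooted graphs by an edge -/

section Join

/-- The graph obtained from disjoint copies of `G` and `H` by joining `r` to `s`. -/
def joinGraph {V W : Type*} (G : SimpleGraph V) (r : V) (H : SimpleGraph W) (s : W) :
    SimpleGraph (V ⊕ W) where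
  Adj x y :=
    match x, y with
    | Sum.inl a, Sum.inl b => G.Adj a b
    | Sum.inl a, Sum.inr b => a = r ∧ b = s
    | Sum.inr a, Sum.inl b => b = r ∧ a = s
    | Sum.inr a, Sum.inr b => H.Adj a b
  symm := ⟨by
    rintro (a | a) (b | b) h
    · exact SimpleGraph.Adj.symm h
    · exact h
    · exact h
    · exact SimpleGraph.Adj.symm h⟩
  loopless := ⟨by
    rintro (a | a) h
    · exact G.loopless.irrefl a h
    · exact H.loopless.irrefl a h⟩

variable {V W : Type*} {G : SimpleGraph V} {r : V} {H : SimpleGraph W} {s : W}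

@[simp] theorem joinGraph_inl_inl {a b : V} :
    (joinGraph G r H s).Adj (Sum.inl a) (Sum.inl b) ↔ G.Adj a b := Iff.rfl

@[simp] theorem joinGraph_inl_inr {a : V} {b : W} :
    (joinGraph G r H s).Adj (Sum.inl a) (Sum.inr b) ↔ a = r ∧ b = s := Iff.rfl

@[simp] theorem joinGraph_inr_inl {a : V} {b : W} :
    (joinGraph G r H s).Adj (Sum.inr b) (Sum.inl a) ↔ a = r ∧ b = s := Iff.rfl

@[simp] theorem joinGraph_inr_inr {a b : W} :
    (joinGraph G r H s).Adj (Sum.inr a) (Sum.inr b) ↔ H.Adj a b := Iff.rfl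

@[simp] theorem corona_inl_inl {a b : V} :
    (corona G).Adj (Sum.inl a) (Sum.inl b) ↔ G.Adj a b := Iff.rfl

@[simp] theorem corona_inl_inr {a b : V} :
    (corona G).Adj (Sum.inl a) (Sum.inr b) ↔ a = b := Iff.rfl

@[simp] theorem corona_inr_inl {a b : V} :
    (corona G).Adj (Sum.inr a) (Sum.inl b) ↔ a = b := Iff.rfl

@[simp] theorem corona_inr_inr {a b : V} :
    ¬ (corona G).Adj (Sum.inr a) (Sum.inr b) := id

open Classical in
theorem nbrSum_joinGraph_inl [Fintype V] [Fintype W] (f : V ⊕ W → ℕ) (v : V) :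
    nbrSum (joinGraph G r H s) f (Sum.inl v) =
      nbrSum G (f ∘ Sum.inl) v + if v = r then f (Sum.inr s) else 0 := by
  by_cases h : v = r <;> simp [nbrSum, Fintype.sum_sum_type, h]

open Classical in
theorem nbrSum_joinGraph_inr [Fintype V] [Fintype W] (f : V ⊕ W → ℕ) (w : W) :
    nbrSum (joinGraph G r H s) f (Sum.inr w) =
      nbrSum H (f ∘ Sum.inr) w + if w = s then f (Sum.inl r) else 0 := by
  by_cases h : w = s <;> simp [nbrSum, Fintype.sum_sum_type, h, add_comm]

/-- Isomorphic rooted graphs have isomorphic joins. -/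
def joinGraphCongr {V' W' : Type*} {G' : SimpleGraph V'} {H' : SimpleGraph W'} {r' : V'} {s' : W'}
    (e : G ≃g G') (e' : H ≃g H') (he : e r = r') (he' : e' s = s') :
    joinGraph G r H s ≃g joinGraph G' r' H' s' where
  toEquiv := e.toEquiv.sumCongr e'.toEquiv
  map_rel_iff' := by
    subst he he'
    rintro (x | x) (y | y)
    · exact e.map_adj_iff
    · exact and_congr e.injective.eq_iff e'.injective.eq_iff
    · exact and_congr e.injective.eq_iff e'.injective.eq_iff
    · exact e'.map_adj_iff

/-- The join of two coronas is the corona of the join. -/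
def joinGraphCoronaIso (G : SimpleGraph V) (r : V) (H : SimpleGraph W) (s : W) :
    joinGraph (corona G) (Sum.inl r) (corona H) (Sum.inl s) ≃g corona (joinGraph G r H s) where
  toEquiv := Equiv.sumSumSumComm V V W W
  map_rel_iff' := by
    rintro ((x | x) | (x | x)) ((y | y) | (y | y)) <;> simp

/-- Two graphs attached at the same vertex can be attached in either order. -/
def joinGraphRightComm (G : SimpleGraph V) (r : V) (H : SimpleGraph W) (s : W) {U : Type*}
    (K : SimpleGraph U) (t : U) :
    joinGraph (joinGraph G r H s) (Sum.inl r) K t ≃g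
      joinGraph (joinGraph G r K t) (Sum.inl r) H s where
  toFun := Sum.elim (Sum.elim (Sum.inl ∘ Sum.inl) Sum.inr) (Sum.inl ∘ Sum.inr)
  invFun := Sum.elim (Sum.elim (Sum.inl ∘ Sum.inl) Sum.inr) (Sum.inl ∘ Sum.inr)
  left_inv := by rintro ((x | x) | x) <;> rfl
  right_inv := by rintro ((x | x) | x) <;> rfl
  map_rel_iff' := by
    rintro ((x | x) | x) ((y | y) | y) <;> simp

end Join

/-! ### Support vertices that persist under joins -/

section RootedSupport

/-- Every vertex of `S` has a neighbour of degree one other than `r`. -/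
def IsRootedSupport {V : Type u} (G : SimpleGraph V) (r : V) (S : Finset V) : Prop :=
  ∀ v ∈ S, ∃ w, w ≠ r ∧ G.Adj v w ∧ ∀ x, G.Adj w x → x = v

variable {V W : Type u} {G : SimpleGraph V} {r : V} {H : SimpleGraph W} {s : W}

/-- A witnessing leaf is not a root, so the new edge does not touch it. -/
theorem IsRootedSupport.join {S : Finset V} {R : Finset W} (hS : IsRootedSupport G r S)
    (hR : IsRootedSupport H s R) :
    IsRootedSupport (joinGraph G r H s) (Sum.inl r) (S.disjSum R) := by
  intro z hz
  rw [Finset.mem_disjSum] at hz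
  obtain ⟨v, hv, rfl⟩ | ⟨v, hv, rfl⟩ := hz
  · obtain ⟨w, hwr, hvw, hw⟩ := hS v hv
    refine ⟨Sum.inl w, by simpa using hwr, hvw, ?_⟩
    rintro (x | x) hx
    · exact congrArg _ (hw x hx)
    · exact absurd hx.1 hwr
  · obtain ⟨w, hws, hvw, hw⟩ := hR v hv
    refine ⟨Sum.inr w, by simp, hvw, ?_⟩
    rintro (x | x) hx
    · exact absurd hx.2 hws
    · exact congrArg _ (hw x hx)

theorem IsRootedSupport.card_le [Finite V] {S : Finset V} (hS : IsRootedSupport G r S) :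
    S.card ≤ supportCount G := by
  rw [supportCount, ← Set.ncard_coe_finset]
  refine Set.ncard_le_ncard (fun v hv => ?_) (Set.toFinite _)
  obtain ⟨w, -, hvw, hw⟩ := hS v hv
  refine ⟨w, hvw, Set.ncard_eq_one.mpr ⟨v, Set.eq_singleton_iff_unique_mem.mpr ⟨hvw.symm, ?_⟩⟩⟩
  exact hw

end RootedSupport

/-! ### Functions with an unfinished root -/

section Partial

/-- `f` has value `x` and neighbour sum at least `p` at `r`, and every other vertex has the
neighbour sum required of a total Roman `{2}`-dominating function. -/
structure IsRootedDF {V : Type u} [Fintype V] (G : SimpleGraph V) (r : V) (x p : ℕ)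
    (f : V → ℕ) : Prop where
  le_two : ∀ v, f v ≤ 2
  root_eq : f r = x
  root_le : p ≤ nbrSum G f r
  need_le : ∀ v, v ≠ r → need (f v) ≤ nbrSum G f v

variable {V W : Type u} [Fintype V] [Fintype W] {G : SimpleGraph V} {r : V}
  {H : SimpleGraph W} {s : W}

theorem IsRootedDF.isTR2DF {x p : ℕ} {f : V → ℕ} (h : IsRootedDF G r x p f) (hp : need x ≤ p) :
    IsTR2DF G f := by
  refine isTR2DF_of_need_le h.le_two fun v => ?_
  by_cases hv : v = r
  · rw [hv, h.root_eq]
    exact hp.trans h.root_le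
  · exact h.need_le v hv

/-- The root of `H` becomes an ordinary vertex and must now be satisfied, with the help of the value
x of its parent; the root of `G` stays unfinished and gains y. -/
theorem IsRootedDF.join {x p y q p' : ℕ} {f : V → ℕ} {g : W → ℕ} (hf : IsRootedDF G r x p f)
    (hg : IsRootedDF H s y q g) (hy : need y ≤ q + x) (hp : p' ≤ p + y) :
    IsRootedDF (joinGraph G r H s) (Sum.inl r) x p' (Sum.elim f g) where
  le_two := by
    rintro (v | w)
    · exact hf.le_two v
    · exact hg.le_two w
  root_eq := hf.root_eq
  root_le := by
    have := hf.root_le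
    have := hg.root_eq
    simp only [nbrSum_joinGraph_inl, Sum.elim_comp_inl, Sum.elim_inr, if_true]
    omega
  need_le := by
    rintro (v | w) hv
    · have h := hf.need_le v fun h => hv (congrArg _ h)
      rw [nbrSum_joinGraph_inl, Sum.elim_comp_inl]
      exact h.trans (Nat.le_add_right _ _)
    · rw [nbrSum_joinGraph_inr, Sum.elim_comp_inr, Sum.elim_inr, Sum.elim_inl]
      by_cases hw : w = s
      · have := hg.root_le
        rw [if_pos hw, hf.root_eq, hw, hg.root_eq]
        omega
      · exact (hg.need_le w hw).trans (Nat.le_add_right _ _)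

end Partial

/-! ### Rooted trees and coronas -/

/-- Finite rooted trees, built from one-vertex trees by making the root of one tree a child of the
root of another. -/
inductive RTree : Type
  | leaf : RTree
  | join : RTree → RTree → RTree

namespace RTree

/-- The vertices of a rooted tree. -/
def carrier : RTree → Type u
  | leaf => PUnit
  | join a b => carrier a ⊕ carrier b

instance instFintypeCarrier : (t : RTree) → Fintype (carrier.{u} t)
  | leaf => inferInstanceAs (Fintype PUnit)
  | join a b =>
    letI := instFintypeCarrier a
    letI := instFintypeCarrier b
    inferInstanceAs (Fintype (carrier.{u} a ⊕ carrier.{u} b))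

/-- The root of a rooted tree. -/
def root : (t : RTree) → carrier.{u} t
  | leaf => PUnit.unit
  | join a _ => Sum.inl (root a)

/-- The underlying graph of a rooted tree. -/
def graph : (t : RTree) → SimpleGraph (carrier.{u} t)
  | leaf => (⊥ : SimpleGraph PUnit)
  | join a b => joinGraph (graph a) (root a) (graph b) (root b)

/-- The tree is a corona, rooted at a vertex of the graph that the corona is taken of. -/
def IsCorona (t : RTree) : Prop :=
  ∃ (W : Type u) (H : SimpleGraph W) (h : W) (e : graph.{u} t ≃g corona H), e t.root = Sum.inl h

/-- Attaching a leaf to the root gives a corona. -/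
def IsBareCorona (t : RTree) : Prop := IsCorona.{u} (join t leaf)

theorem isCorona_edge : IsCorona.{u} (join leaf leaf) := by
  refine ⟨PUnit, ⊥, PUnit.unit, ⟨Equiv.refl _, ?_⟩, rfl⟩
  rintro (a | a) (b | b)
  · exact Iff.rfl
  · exact iff_of_true rfl ⟨rfl, rfl⟩
  · exact iff_of_true rfl ⟨rfl, rfl⟩
  · exact iff_of_false id id

theorem IsCorona.join {a b : RTree} (ha : IsCorona.{u} a) (hb : IsCorona.{u} b) :
    IsCorona.{u} (join a b) := by
  obtain ⟨V, G, g, e, he⟩ := ha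
  obtain ⟨W, H, h, e', he'⟩ := hb
  refine ⟨V ⊕ W, joinGraph G g H h, Sum.inl g,
    (joinGraphCongr e e' he he').trans (joinGraphCoronaIso G g H h), ?_⟩
  change Equiv.sumSumSumComm V V W W (Sum.inl (e a.root)) = _
  rw [he]
  rfl

/-- The missing leaf may be attached before or after the child `b`. -/
theorem IsBareCorona.join {a b : RTree} (ha : IsBareCorona.{u} a) (hb : IsCorona.{u} b) :
    IsBareCorona.{u} (join a b) := by
  obtain ⟨W, H, h, e, he⟩ := IsCorona.join ha hb
  exact ⟨W, H, h, (joinGraphRightComm _ _ _ _ _ _).trans e, he⟩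

end RTree

/-! ### The finite table of profiles -/

/-- The types of rooted trees distinguished in the induction. -/
inductive Profile
  | leaf | corona | edge | heavy | support | bare | open | one | satisfied
  deriving DecidableEq

namespace Profile

/-- The bounds `(x, p, b)` of a profile: there is a rooted dominating function with value `x` and
neighbour sum at least `p` at the root, such that four times its weight exceeds three times the
order plus twice the number of support vertices by at most `b`. -/
def bounds : Profile → List (ℕ × ℕ × ℤ)
  | leaf => [(0, 0, -3), (1, 0, 1), (2, 0, 5)]
  | corona => [(2, 0, 0), (2, 1, 0)]
  | edge => [(1, 0, 0), (1, 1, 0), (2, 0, 0)]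
  | heavy => [(2, 0, -2)]
  | support => [(2, 0, -1), (2, 1, 0)]
  -- A corona has excess 0. Omitting the root's leaf lowers 3n + 2s by 5, and a root value x
  -- replaces a pair of weight 2, so the excess is 4x − 8 + 5 = 4x − 3. The entry (1, 1, 2) is
  -- weaker than this, which is harmless.
  | bare => [(0, 0, -3), (0, 1, -3), (1, 0, 1), (1, 1, 2), (2, 0, 5), (2, 1, 5)]
  | .open => [(0, 0, -3), (0, 1, -3), (1, 0, 1), (1, 1, 2), (2, 0, 4), (2, 1, 4)]
  | one => [(1, 0, -2), (2, 0, 3)]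
  | satisfied => [(1, 0, -1), (1, 1, 0), (2, 0, 4), (2, 1, 5)]

/-- The root has a leaf as a child. -/
def isSupport : Profile → Bool
  | corona | edge | heavy | support => true
  | _ => false

/-- The profile of a join. -/
def join : Profile → Profile → Profile
  | leaf, leaf => edge
  | leaf, corona | leaf, edge => bare
  | corona, corona | corona, edge | edge, corona | edge, edge => corona
  | corona, support | corona, satisfied | edge, support | edge, satisfied => support
  | corona, _ | edge, _ | heavy, _ => heavy
  | support, corona | support, edge => support
  | support, _ => heavy
  | bare, leaf => corona
  | bare, corona | bare, edge => bare
  | .open, leaf => support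
  | .open, corona | .open, edge => .open
  | leaf, heavy | leaf, one | bare, heavy | bare, one | .open, heavy | .open, one => satisfied
  | leaf, support | leaf, satisfied | bare, support | bare, satisfied | .open, support
  | .open, satisfied => .open
  | leaf, _ | bare, _ | .open, _ => one
  | one, leaf => heavy
  | one, _ => one
  | satisfied, leaf => support
  | satisfied, corona | satisfied, edge => satisfied
  | satisfied, _ => one

/-- The number of support vertices that a join creates. -/
def newSupport (i j : Profile) : ℕ := if i.isSupport = false ∧ j = leaf then 1 else 0

theorem isSupport_join (i j : Profile) : (i.join j).isSupport = (i.isSupport || j = leaf) := by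
  cases i <;> cases j <;> rfl

/-- The bounds of the profile of a join follow from those of the two profiles. -/
theorem exists_bounds_of_mem_join (i j : Profile) : ∀ e ∈ (i.join j).bounds,
    ∃ a ∈ i.bounds, ∃ b ∈ j.bounds, a.1 = e.1 ∧ need b.1 ≤ b.2.1 + a.1 ∧
      e.2.1 ≤ a.2.1 + b.1 ∧ a.2.2 + b.2.2 - 2 * newSupport i j ≤ e.2.2 := by
  cases i <;> cases j <;> decide

/-- Joining a tree with at least two vertices to another gives an unrooted dominating function of
weight strictly within the bound, unless the join is a corona or has three vertices. -/
theorem exists_bounds_lt (i j : Profile) (hi : i ≠ leaf) (hij : ¬ (i = edge ∧ j = leaf)) :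
    ∃ a ∈ i.bounds, ∃ b ∈ j.bounds, need b.1 ≤ b.2.1 + a.1 ∧
      need a.1 ≤ a.2.1 + b.1 ∧
      a.2.2 + b.2.2 - 2 * newSupport i j ≤ if i.join j = corona then 0 else -1 := by
  revert hi hij
  cases i <;> cases j <;> decide

end Profile

/-! ### Every rooted tree has a profile -/

open Profile in
/-- The structural property that comes with a profile. -/
def Profile.Shape (t : RTree) : Profile → Prop
  | leaf => t = .leaf
  | edge => t = .join .leaf .leaf
  | corona => t.IsCorona.{u}
  | bare => t.IsBareCorona.{u}
  | _ => True

/-- The rooted tree `t` has profile `i`. -/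
def RTree.HasProfile (t : RTree) (i : Profile) : Prop :=
  i.Shape.{u} t ∧ ∃ S : Finset (RTree.carrier.{u} t), IsRootedSupport t.graph t.root S ∧
    (t.root ∈ S ↔ i.isSupport) ∧ ∀ e ∈ i.bounds, ∃ f : RTree.carrier.{u} t → ℕ,
      IsRootedDF t.graph t.root e.1 e.2.1 f ∧
        4 * ((∑ v, f v : ℕ) : ℤ) ≤ 3 * Fintype.card (RTree.carrier.{u} t) + 2 * S.card + e.2.2

namespace RTree

theorem card_leaf : Fintype.card (carrier.{u} leaf) = 1 := rfl

theorem card_join (a b : RTree) : Fintype.card (carrier.{u} (join a b)) =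
    Fintype.card (carrier.{u} a) + Fintype.card (carrier.{u} b) := Fintype.card_sum

theorem sum_join (a b : RTree) (f : carrier.{u} a → ℕ) (g : carrier.{u} b → ℕ) :
    (∑ v : carrier.{u} (join a b), (Sum.elim f g : _ → ℕ) v) = ∑ v, f v + ∑ w, g w :=
  Fintype.sum_sum_type _

theorem hasProfile_leaf : HasProfile.{u} leaf .leaf := by
  refine ⟨rfl, ∅, fun v hv => absurd hv (Finset.notMem_empty v), by simp [Profile.isSupport],
    fun e he => ⟨fun _ => e.1, ⟨fun _ => ?_, rfl, ?_, fun v hv => absurd rfl hv⟩, ?_⟩⟩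
  · revert e; decide
  · have : e.2.1 = 0 := by revert e; decide
    rw [this]
    exact Nat.zero_le _
  · rw [card_leaf, show (∑ _v : carrier.{u} leaf, e.1) = e.1 from
      Fintype.sum_unique (ι := PUnit) fun _ => e.1]
    revert e
    simp [Profile.bounds]

/-- An edge is also a corona and a single vertex is also a bare corona, which covers the mixed
cases. -/
theorem shape_join {a b : RTree} {i j : Profile} (ha : i.Shape.{u} a) (hb : j.Shape.{u} b) :
    (i.join j).Shape.{u} (join a b) := by
  have edge : ∀ {t : RTree}, Profile.Shape.{u} t .edge → t.IsCorona.{u} := by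
    rintro _ rfl
    exact isCorona_edge
  have leaf : ∀ {t : RTree}, Profile.Shape.{u} t .leaf → t.IsBareCorona.{u} := by
    rintro _ rfl
    exact isCorona_edge
  cases i <;> cases j <;> first
    | exact trivial
    | exact IsCorona.join ha hb
    | exact IsCorona.join (edge ha) hb
    | exact IsCorona.join ha (edge hb)
    | exact IsCorona.join (edge ha) (edge hb)
    | exact IsBareCorona.join ha hb
    | exact IsBareCorona.join (leaf ha) hb
    | exact IsBareCorona.join ha (edge hb)
    | exact IsBareCorona.join (leaf ha) (edge hb)
    | (cases ha; cases hb; rfl)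
    | (cases hb; exact ha)

/-- The support vertices of a join, given those of the two trees. -/
theorem exists_isRootedSupport_join {a b : RTree} {i j : Profile} (hj : j.Shape.{u} b)
    {S : Finset (carrier.{u} a)} {R : Finset (carrier.{u} b)}
    (hS : IsRootedSupport (graph a) (root a) S) (hR : IsRootedSupport (graph b) (root b) R)
    (hSi : root a ∈ S ↔ i.isSupport) :
    ∃ U : Finset (carrier.{u} (join a b)), IsRootedSupport (graph (join a b)) (root (join a b)) U ∧
      (root (join a b) ∈ U ↔ (i.join j).isSupport) ∧
      U.card = S.card + R.card + Profile.newSupport i j := by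
  classical
  have hSR := hS.join hR
  by_cases h : i.isSupport = false ∧ j = .leaf
  · obtain ⟨hi, rfl⟩ := h
    cases hj
    have hr : Sum.inl (root a) ∉ S.disjSum R := by
      rw [Finset.inl_mem_disjSum, hSi, hi]
      exact Bool.false_ne_true
    refine ⟨Finset.cons (Sum.inl (root a)) (S.disjSum R) hr, ?_, ?_, ?_⟩
    · intro v hv
      obtain rfl | hv := Finset.mem_cons.mp hv
      · refine ⟨Sum.inr PUnit.unit, Sum.inr_ne_inl, ⟨rfl, rfl⟩, ?_⟩
        rintro (x | x) hx
        · exact congrArg _ hx.1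
        · exact hx.elim
      · exact hSR v hv
    · refine iff_of_true (Finset.mem_cons_self _ _) ?_
      rw [Profile.isSupport_join]
      simp
    · refine (Finset.card_cons hr).trans ?_
      rw [Finset.card_disjSum, Profile.newSupport, if_pos ⟨hi, rfl⟩]
  · refine ⟨S.disjSum R, hSR, ?_, ?_⟩
    · refine Finset.inl_mem_disjSum.trans (hSi.trans ?_)
      rw [Profile.isSupport_join]
      cases hi : i.isSupport
      · simpa [hi] using h
      · simp
    · rw [Profile.newSupport, if_neg h]
      exact Finset.card_disjSum S R

/-- Weights and orders add up, and support counts do so up to `newSupport`; hence so do the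
excesses, up to the term 2 · `newSupport`. -/
theorem HasProfile.join {a b : RTree} {i j : Profile} (ha : HasProfile.{u} a i)
    (hb : HasProfile.{u} b j) : HasProfile.{u} (join a b) (i.join j) := by
  obtain ⟨hi, S, hS, hSi, hf⟩ := ha
  obtain ⟨hj, R, hR, -, hg⟩ := hb
  obtain ⟨U, hU, hUr, hUc⟩ := exists_isRootedSupport_join (i := i) hj hS hR hSi
  refine ⟨shape_join hi hj, U, hU, hUr, fun e he => ?_⟩
  obtain ⟨p, hp, q, hq, hpe, hqn, hep, hle⟩ := Profile.exists_bounds_of_mem_join i j e he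
  obtain ⟨f, hf, hfle⟩ := hf p hp
  obtain ⟨g, hg, hgle⟩ := hg q hq
  refine ⟨Sum.elim f g, hpe ▸ hf.join hg hqn hep, ?_⟩
  rw [sum_join, card_join, hUc]
  push_cast at *
  linarith

theorem exists_hasProfile (t : RTree) : ∃ i, HasProfile.{u} t i := by
  induction t with
  | leaf => exact ⟨_, hasProfile_leaf⟩
  | join a b iha ihb =>
    obtain ⟨i, hi⟩ := iha
    obtain ⟨j, hj⟩ := ihb
    exact ⟨_, hi.join hj⟩

/-- The bound for a rooted tree whose root has at least two children. -/
theorem four_mul_gammaTR2_le {a b : RTree} (ha : a ≠ leaf)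
    (hn : 4 ≤ Fintype.card (carrier.{u} (join a b))) :
    4 * gammaTR2 (graph.{u} (join a b)) ≤
        3 * Fintype.card (carrier.{u} (join a b)) + 2 * supportCount (graph.{u} (join a b)) ∧
      (4 * gammaTR2 (graph.{u} (join a b)) =
          3 * Fintype.card (carrier.{u} (join a b)) + 2 * supportCount (graph.{u} (join a b)) →
        IsCorona.{u} (join a b)) := by
  obtain ⟨i, hi, S, hS, hSi, hf⟩ := exists_hasProfile.{u} a
  obtain ⟨j, hj, R, hR, -, hg⟩ := exists_hasProfile.{u} b
  obtain ⟨U, hU, -, hUc⟩ := exists_isRootedSupport_join (i := i) hj hS hR hSi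
  have hc := hU.card_le
  have hne : i ≠ .leaf := by
    rintro rfl
    exact ha hi
  -- This join is the path on three vertices, where the bound fails: 4 · 3 > 3 · 3 + 2 · 1.
  have hij : ¬ (i = .edge ∧ j = .leaf) := by
    rintro ⟨rfl, rfl⟩
    cases hi
    cases hj
    exact absurd hn (by simp [card_join, card_leaf])
  obtain ⟨p, hp, q, hq, hqn, hpn, hle⟩ := Profile.exists_bounds_lt i j hne hij
  obtain ⟨f, hf, hfle⟩ := hf p hp
  obtain ⟨g, hg, hgle⟩ := hg q hq
  have hγ : gammaTR2 (graph.{u} (RTree.join a b)) ≤ ∑ v, f v + ∑ w, g w :=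
    (sum_join a b f g) ▸ gammaTR2_le ((hf.join hg hqn le_rfl).isTR2DF hpn)
  rw [card_join] at hn ⊢
  have key := shape_join hi hj
  split_ifs at hle with hcor
  · rw [hcor] at key
    exact ⟨by omega, fun _ => key⟩
  · exact ⟨by omega, fun h => by omega⟩

end RTree

/-! ### Lower bound for coronas -/

section Corona

variable {W : Type u} {H : SimpleGraph W}

/-- A total Roman `{2}`-dominating function of a corona has weight at least its order. -/
theorem two_mul_card_le_sum_of_isTR2DF_corona [Fintype W] {f : W ⊕ W → ℕ}
    (hf : IsTR2DF (corona H) f) : 2 * Fintype.card W ≤ ∑ v, f v := by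
  -- The only neighbour of the leaf `inr a` is `inl a`: a leaf of value 0 forces value 2 there, and
  -- a positive leaf forces a positive value there.
  have h : ∀ a : W, 2 ≤ f (Sum.inl a) + f (Sum.inr a) := by
    intro a
    by_cases h0 : f (Sum.inr a) = 0
    · obtain ⟨u | u, hu, h2⟩ | ⟨x | x, y | y, hxy, hx, hy, -, -⟩ := hf.dominates _ h0
      · rw [corona_inr_inl.mp hu, h2]
        exact Nat.le_add_right _ _
      · exact absurd hu corona_inr_inr
      · exact absurd (congrArg Sum.inl ((corona_inr_inl.mp hx).symm.trans (corona_inr_inl.mp hy)))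
          hxy
      · exact absurd hy corona_inr_inr
      · exact absurd hx corona_inr_inr
      · exact absurd hx corona_inr_inr
    · obtain ⟨u | u, hu, h2⟩ := hf.total _ (Nat.pos_of_ne_zero h0)
      · rw [← corona_inr_inl.mp hu] at h2
        omega
      · exact absurd hu corona_inr_inr
  rw [Fintype.sum_sum_type, ← Finset.sum_add_distrib, mul_comm, ← smul_eq_mul, ← Finset.card_univ,
    ← Finset.sum_const]
  exact Finset.sum_le_sum fun a _ => h a

/-- The corona of a graph without isolated vertices has no more support vertices than half its
order. -/
theorem supportCount_corona_le [Fintype W] (h : ∀ v, ∃ w, H.Adj v w) :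
    supportCount (corona H) ≤ Fintype.card W := by
  rw [← Nat.card_eq_fintype_card, ← Set.ncard_univ,
    ← Set.ncard_image_of_injective _ (Sum.inl_injective (α := W) (β := W)), supportCount]
  refine Set.ncard_le_ncard ?_ (Set.toFinite _)
  rintro (a | a) ⟨w | w, haw, hw⟩
  · exact ⟨a, trivial, rfl⟩
  · exact ⟨a, trivial, rfl⟩
  -- A vertex of `H` is never a leaf of the corona: it has a neighbour in `H` besides its own leaf.
  · obtain ⟨z, hz⟩ := Set.ncard_eq_one.mp hw
    obtain ⟨b, hb⟩ := h w
    have h1 : (Sum.inl b : W ⊕ W) ∈ (corona H).neighborSet (Sum.inl w) := hb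
    have h2 : (Sum.inr a : W ⊕ W) ∈ (corona H).neighborSet (Sum.inl w) := haw.symm
    rw [hz] at h1 h2
    exact absurd (h1.trans h2.symm) Sum.inl_ne_inr
  · exact absurd haw corona_inr_inr

/-- If the corona of `H` is a tree, then so is `H`. -/
theorem isTree_of_isTree_corona (h : (corona H).IsTree) : H.IsTree := by
  refine ⟨?_, h.isAcyclic.comap ⟨Sum.inl, id⟩ Sum.inl_injective⟩
  have hn : Nonempty W := h.connected.nonempty.elim (Sum.elim Nonempty.intro Nonempty.intro)
  refine ⟨fun a b => ?_⟩
  -- Contracting each pendant edge sends walks of the corona to walks of `H`.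
  have key : ∀ x y, (corona H).Reachable x y →
      H.Reachable (Sum.elim id id x) (Sum.elim id id y) := by
    rintro x y ⟨p⟩
    induction p with
    | nil => exact SimpleGraph.Reachable.refl _
    | @cons u v w huv _ ih =>
      refine SimpleGraph.Reachable.trans ?_ ih
      rcases u with u | u <;> rcases v with v | v
      · exact SimpleGraph.Adj.reachable huv
      · exact (corona_inl_inr.mp huv) ▸ SimpleGraph.Reachable.refl _
      · exact (corona_inr_inl.mp huv) ▸ SimpleGraph.Reachable.refl _
      · exact absurd huv corona_inr_inr
  exact key _ _ (h.connected.preconnected (Sum.inl a) (Sum.inl b))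

end Corona

/-! ### Trees as rooted trees -/

section Decomposition

variable {V : Type u} {G : SimpleGraph V}

/-- Deleting the edge `r u` of a tree splits it into two trees. -/
theorem exists_isTree_induce_compl (hG : G.IsTree) {r u : V} (hru : G.Adj r u) :
    ∃ s : Set V, r ∈ s ∧ u ∈ sᶜ ∧ (G.induce s).IsTree ∧ (G.induce sᶜ).IsTree ∧
      ∀ a ∈ s, ∀ b ∈ sᶜ, G.Adj a b ↔ a = r ∧ b = u := by
  set G' := G.deleteEdges {s(r, u)} with hG'
  have hle : G' ≤ G := SimpleGraph.deleteEdges_le _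
  have hnr : ¬ G'.Reachable r u :=
    SimpleGraph.isBridge_iff.mp (SimpleGraph.isAcyclic_iff_forall_adj_isBridge.mp hG.isAcyclic hru)
  -- Deleting the bridge leaves exactly two components, those of `r` and `u`; the set sought is the
  -- first.
  have hcov : ∀ v, G'.Reachable r v ∨ G'.Reachable u v := by
    have key : ∀ x y, G.Walk x y → (G'.Reachable r x ∨ G'.Reachable u x) →
        (G'.Reachable r y ∨ G'.Reachable u y) := by
      intro x y p
      induction p with
      | nil => exact id
      | @cons x v w hxv _ ih =>
        intro hx
        apply ih
        by_cases he : s(x, v) = s(r, u)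
        · rcases Sym2.eq_iff.mp he with ⟨-, rfl⟩ | ⟨-, rfl⟩
          · exact Or.inr (SimpleGraph.Reachable.refl _)
          · exact Or.inl (SimpleGraph.Reachable.refl _)
        · have hxv' : G'.Reachable x v :=
            (SimpleGraph.deleteEdges_adj.mpr ⟨hxv, he⟩ : G'.Adj x v).reachable
          exact hx.imp (·.trans hxv') (·.trans hxv')
    intro v
    obtain ⟨p⟩ := hG.connected.preconnected r v
    exact key r v p (Or.inl (SimpleGraph.Reachable.refl _))
  have hs : {v | G'.Reachable r v} = (G'.connectedComponentMk r).supp := by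
    ext v
    simp [SimpleGraph.reachable_comm]
  have ht : {v | G'.Reachable r v}ᶜ = (G'.connectedComponentMk u).supp := by
    ext v
    simp only [Set.mem_compl_iff, Set.mem_ofPred_eq, SimpleGraph.ConnectedComponent.mem_supp_iff,
      SimpleGraph.ConnectedComponent.eq]
    exact ⟨fun h => ((hcov v).resolve_left h).symm, fun h h' => hnr (h'.trans h)⟩
  have htree : ∀ (C : G'.ConnectedComponent) (s : Set V), s = C.supp → (G.induce s).IsTree := by
    rintro C _ rfl
    exact ⟨C.connected_toSimpleGraph.mono (SimpleGraph.comap_monotone _ hle), hG.isAcyclic.induce _⟩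
  refine ⟨{v | G'.Reachable r v}, SimpleGraph.Reachable.refl _, hnr, htree _ _ hs, htree _ _ ht,
    fun a ha b hb => ⟨fun hab => ?_, ?_⟩⟩
  · by_cases he : s(a, b) = s(r, u)
    · rcases Sym2.eq_iff.mp he with h | ⟨rfl, rfl⟩
      · exact h
      · exact absurd (SimpleGraph.Reachable.refl _) hb
    · have : G'.Adj a b := SimpleGraph.deleteEdges_adj.mpr ⟨hab, he⟩
      exact absurd (SimpleGraph.Reachable.trans ha this.reachable) hb
  · rintro ⟨rfl, rfl⟩
    exact hru

/-- A graph with a single edge `r u` between `s` and its complement is a join. -/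
theorem exists_iso_joinGraph {r u : V} {s : Set V} (hr : r ∈ s) (hu : u ∈ sᶜ)
    (h : ∀ a ∈ s, ∀ b ∈ sᶜ, G.Adj a b ↔ a = r ∧ b = u) :
    ∃ e : G ≃g joinGraph (G.induce s) ⟨r, hr⟩ (G.induce sᶜ) ⟨u, hu⟩, e r = Sum.inl ⟨r, hr⟩ := by
  classical
  let e : joinGraph (G.induce s) ⟨r, hr⟩ (G.induce sᶜ) ⟨u, hu⟩ ≃g G :=
    { toEquiv := Equiv.Set.sumCompl s
      map_rel_iff' := by
        rintro (⟨a, ha⟩ | ⟨a, ha⟩) (⟨b, hb⟩ | ⟨b, hb⟩)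
        · exact Iff.rfl
        · simpa using h a ha b hb
        · simpa [G.adj_comm a b] using h b hb a ha
        · exact Iff.rfl }
  refine ⟨e.symm, ?_⟩
  rw [← e.injective.eq_iff]
  exact e.apply_symm_apply r

/-- Every finite tree is isomorphic to the graph of a rooted tree, with any root. -/
theorem exists_iso_rTree : ∀ (n : ℕ) {V : Type u} [Fintype V] {G : SimpleGraph V},
    G.IsTree → ∀ r : V, Fintype.card V = n →
      ∃ (t : RTree) (e : G ≃g RTree.graph.{u} t), e r = t.root := by
  intro n
  induction n using Nat.strong_induction_on with
  | _ n ih =>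
  intro V _ G hG r hn
  classical
  by_cases h : ∃ u, G.Adj r u
  · obtain ⟨u, hru⟩ := h
    obtain ⟨s, hr, hu, hs, hsc, hadj⟩ := exists_isTree_induce_compl hG hru
    obtain ⟨e, he⟩ := exists_iso_joinGraph hr hu hadj
    have hcard : Fintype.card V = Fintype.card s + Fintype.card (sᶜ : Set V) := by
      rw [← Fintype.card_sum]
      exact Fintype.card_congr e.toEquiv
    have h1 : 0 < Fintype.card s := Fintype.card_pos_iff.mpr ⟨⟨r, hr⟩⟩
    have h2 : 0 < Fintype.card (sᶜ : Set V) := Fintype.card_pos_iff.mpr ⟨⟨u, hu⟩⟩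
    obtain ⟨a, ea, hea⟩ := ih _ (by omega) hs ⟨r, hr⟩ rfl
    obtain ⟨b, eb, heb⟩ := ih _ (by omega) hsc ⟨u, hu⟩ rfl
    refine ⟨.join a b, e.trans (joinGraphCongr ea eb hea heb), ?_⟩
    change (joinGraphCongr ea eb hea heb) (e r) = _
    rw [he]
    exact congrArg Sum.inl hea
  · have hall : ∀ v, v = r := by
      intro v
      obtain ⟨p⟩ := hG.connected.preconnected r v
      cases p with
      | nil => rfl
      | cons hrv _ => exact absurd ⟨_, hrv⟩ h
    refine ⟨.leaf, ⟨⟨fun _ => PUnit.unit, fun _ => r, fun v => (hall v).symm, fun _ => rfl⟩, ?_⟩,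
      rfl⟩
    intro a b
    rw [hall a, hall b]
    exact iff_of_false id G.irrefl

end Decomposition

/-! ### Invariance under isomorphism -/

section Iso

variable {V W : Type*} {G : SimpleGraph V} {H : SimpleGraph W}

theorem isLeaf_iso (e : G ≃g H) {v : V} : IsLeaf H (e v) ↔ IsLeaf G v := by
  unfold IsLeaf
  rw [← Nat.card_coe_set_eq, ← Nat.card_coe_set_eq,
    Nat.card_congr (e.mapNeighborSet v)]

theorem isSupportVertex_iso (e : G ≃g H) {v : V} :
    IsSupportVertex H (e v) ↔ IsSupportVertex G v := by
  constructor
  · rintro ⟨w, hvw, hw⟩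
    obtain ⟨w, rfl⟩ := e.surjective w
    exact ⟨w, e.map_adj_iff.mp hvw, (isLeaf_iso e).mp hw⟩
  · rintro ⟨w, hvw, hw⟩
    exact ⟨e w, e.map_adj_iff.mpr hvw, (isLeaf_iso e).mpr hw⟩

theorem supportCount_iso (e : G ≃g H) : supportCount G = supportCount H := by
  rw [supportCount, supportCount, ← Set.ncard_image_of_injective _ e.injective]
  congr 1
  ext w
  obtain ⟨v, rfl⟩ := e.surjective w
  simp [e.injective.mem_set_image, isSupportVertex_iso e]

theorem IsTR2DF.comp_iso (e : G ≃g H) {f : W → ℕ} (hf : IsTR2DF H f) : IsTR2DF G (f ∘ e) where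
  le_two v := hf.le_two _
  dominates v hv := by
    obtain ⟨u, hu, h⟩ | ⟨x, y, hxy, hx, hy, h, h'⟩ := hf.dominates _ hv
    · obtain ⟨u, rfl⟩ := e.surjective u
      exact Or.inl ⟨u, e.map_adj_iff.mp hu, h⟩
    · obtain ⟨x, rfl⟩ := e.surjective x
      obtain ⟨y, rfl⟩ := e.surjective y
      exact Or.inr ⟨x, y, fun h => hxy (congrArg e h), e.map_adj_iff.mp hx, e.map_adj_iff.mp hy,
        h, h'⟩
  total v hv := by
    obtain ⟨u, hu, h⟩ := hf.total _ hv
    obtain ⟨u, rfl⟩ := e.surjective u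
    exact ⟨u, e.map_adj_iff.mp hu, h⟩

theorem gammaTR2_iso [Fintype V] [Fintype W] (e : G ≃g H) : gammaTR2 G = gammaTR2 H := by
  unfold gammaTR2
  congr 1
  ext w
  constructor
  · rintro ⟨f, hf, rfl⟩
    exact ⟨f ∘ e.symm, hf.comp_iso e.symm, e.symm.toEquiv.sum_comp f⟩
  · rintro ⟨f, hf, rfl⟩
    exact ⟨f ∘ e, hf.comp_iso e, e.toEquiv.sum_comp f⟩

end Iso

/-! ### The two directions for trees -/

section Main

variable {V : Type u} [Fintype V] {T : SimpleGraph V}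

/-- A tree with at least three vertices has a vertex with two distinct
neighbours. -/
theorem exists_two_adj (hT : T.IsTree) (hn : 3 ≤ Fintype.card V) :
    ∃ r x y, x ≠ y ∧ T.Adj r x ∧ T.Adj r y := by
  by_contra! h
  obtain ⟨v⟩ := hT.connected.nonempty
  -- If no vertex has two neighbours, a walk never leaves the edge on which it starts.
  have key : ∀ a b, T.Walk a b → ∀ w, T.Adj a w → b = a ∨ b = w := by
    intro a b p
    induction p with
    | nil => exact fun w _ => Or.inl rfl
    | @cons a c b hac _ ih =>
      intro w hw
      have : c = w := by
        by_contra hcw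
        exact h a c w hcw hac hw
      rcases ih a hac.symm with rfl | rfl
      · exact Or.inr this
      · exact Or.inl rfl
  obtain ⟨u, hu⟩ := Fintype.exists_ne_of_one_lt_card (by omega) v
  obtain ⟨p⟩ := hT.connected.preconnected v u
  cases p with
  | nil => exact hu rfl
  | @cons _ c _ hvc p =>
    classical
    have hsub : (Finset.univ : Finset V) ⊆ {v, c} := by
      intro x _
      obtain ⟨q⟩ := hT.connected.preconnected v x
      simpa using key v x q c hvc
    have := (Finset.card_le_card hsub).trans Finset.card_le_two
    rw [Finset.card_univ] at this
    omega

theorem four_mul_gammaTR2_le_of_isTree (hT : T.IsTree) (hn : 4 ≤ Fintype.card V) :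
    4 * gammaTR2 T ≤ 3 * Fintype.card V + 2 * supportCount T ∧
      (4 * gammaTR2 T = 3 * Fintype.card V + 2 * supportCount T → IsCoronaOfTree T) := by
  obtain ⟨r, x, y, hxy, hx, hy⟩ := exists_two_adj hT (by omega)
  obtain ⟨t, e, he⟩ := exists_iso_rTree _ hT r rfl
  have hcard : Fintype.card V = Fintype.card (RTree.carrier.{u} t) :=
    Fintype.card_congr e.toEquiv
  have hx' : (RTree.graph.{u} t).Adj t.root (e x) := he ▸ e.map_adj_iff.mpr hx
  have hy' : (RTree.graph.{u} t).Adj t.root (e y) := he ▸ e.map_adj_iff.mpr hy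
  have hxy' : e x ≠ e y := fun h => hxy (e.injective h)
  rw [gammaTR2_iso e, supportCount_iso e, hcard]
  rw [hcard] at hn
  generalize e x = x' at hx' hxy'
  generalize e y = y' at hy' hxy'
  cases t with
  | leaf => exact hx'.elim
  | join a b =>
    -- If `a` were a single vertex, the root would have only one neighbour, the root of `b`.
    have ha : a ≠ .leaf := by
      rintro rfl
      obtain x' | x' := x'
      · exact hx'.elim
      obtain y' | y' := y'
      · exact hy'.elim
      exact hxy' (congrArg Sum.inr (hx'.2.trans hy'.2.symm))
    obtain ⟨h1, h2⟩ := RTree.four_mul_gammaTR2_le ha hn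
    refine ⟨h1, fun h => ?_⟩
    obtain ⟨W, H, -, e', -⟩ := h2 h
    have hT' : (corona H).IsTree := (SimpleGraph.Iso.isTree_iff (e.trans e')).mp hT
    exact ⟨W, H, isTree_of_isTree_corona hT', ⟨e.trans e'⟩⟩

/-- With k vertices in the underlying tree, 3n + 2s ≤ 6k + 2k = 4 · 2k, and 2k bounds the weight
from below. Since n ≥ 4, that tree has at least two vertices and hence no isolated ones. -/
theorem le_four_mul_gammaTR2_of_isCoronaOfTree (hT : T.IsTree) (hn : 4 ≤ Fintype.card V)
    (h : IsCoronaOfTree T) : 3 * Fintype.card V + 2 * supportCount T ≤ 4 * gammaTR2 T := by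
  obtain ⟨W, H, hH, ⟨e⟩⟩ := h
  have : Finite (W ⊕ W) := Finite.of_equiv V e.toEquiv
  have : Finite W := Finite.of_injective (Sum.inl : W → W ⊕ W) Sum.inl_injective
  have := Fintype.ofFinite W
  have hcard : Fintype.card V = Fintype.card W + Fintype.card W := by
    rw [← Fintype.card_sum]
    exact Fintype.card_congr e.toEquiv
  have : Nontrivial V := Fintype.one_lt_card_iff_nontrivial.mp (by omega)
  have : Nontrivial W := Fintype.one_lt_card_iff_nontrivial.mp (by omega)
  have hs := supportCount_corona_le fun v => hH.connected.preconnected.exists_adj_of_nontrivial v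
  obtain ⟨f, hf, hsum⟩ := exists_isTR2DF_sum_eq_gammaTR2
    (isTR2DF_one fun v => hT.connected.preconnected.exists_adj_of_nontrivial v)
  have hγ := two_mul_card_le_sum_of_isTR2DF_corona (hf.comp_iso e.symm)
  rw [show ∑ v, (f ∘ e.symm) v = gammaTR2 T from (e.symm.toEquiv.sum_comp f).trans hsum] at hγ
  rw [supportCount_iso e, hcard]
  omega

end Main

end TotalRoman

theorem mainTheorem1 {V : Type u} [Fintype V] (T : SimpleGraph V) (hT : T.IsTree)
    (hn : 4 ≤ Fintype.card V) :
    (TotalRoman.gammaTR2 T : ℝ) ≤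
        (3 * (Fintype.card V : ℝ) + 2 * (TotalRoman.supportCount T : ℝ)) / 4 ∧
      ((TotalRoman.gammaTR2 T : ℝ) =
          (3 * (Fintype.card V : ℝ) + 2 * (TotalRoman.supportCount T : ℝ)) / 4 ↔
        TotalRoman.IsCoronaOfTree T) := by
  obtain ⟨hle, heq⟩ := TotalRoman.four_mul_gammaTR2_le_of_isTree hT hn
  rw [le_div_iff₀ (by norm_num), eq_div_iff (by norm_num), mul_comm]
  refine ⟨by exact_mod_cast hle, fun h => heq (by exact_mod_cast h), fun h => ?_⟩
  exact_mod_cast hle.antisymm (TotalRoman.le_four_mul_gammaTR2_of_isCoronaOfTree hT hn h)
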